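/- Let $G$ be a finite connected bipartite graph without multiple edges, with color classes $E$ and $V$ and at least one edge, and put $d=|E|+|V|-2$. Let $Q_G\subset\mathbf R^E\oplus\mathbf R^V$ be its root polytope, that is, the convex hull of the vectors $\mathbf i_{e}+\mathbf i_{v}$ for all edges $ev$ of $G$ ($e\in E$, $v\in V$), where $\mathbf i_x$ denotes the standard basis vector indexed by $x$. For $s\in\mathbf N=\{0,1,2,\dots\}$ let $\varepsilon_G(s)=\left|(s\cdot Q_G)\cap(\mathbf Z^E\oplus\mathbf Z^V)\right|$ be the Ehrhart polynomial of $Q_G$. There are unique rational numbers $a_0,\dots,a_d$ such that \[\varepsilon_G(s)=\sum_{k=0}^{d}a_k\binom{s+d-k}{d}\qquad\text{for all } s\in\mathbf N.\] A triangulation of $Q_G$ is a collection of maximal (that is, of the same dimension as $Q_G$) simplices, each spanned by vertices of $Q_G$, such that each two intersect in a common (possibly empty) face and their union is $Q_G$. If the simplicial complex consisting of these simplices and all their faces has dimension $\delta$ and exactly $f_k$ simplices of dimension $k$ for $0\le k\le\delta$, then its $f$-vector is the polynomial $f(y)=y^{\delta+1}+f_0y^{\delta}+f_1y^{\delta-1}+\cdots+f_{\delta}$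 and its $h$-vector is the polynomial $h(x)=f(x-1)$. Then the $h$-vector $h$ of any triangulation of $Q_G$ satisfies \[x^{d+1}\,h(x^{-1})=a_0+a_1x+a_2x^2+\cdots+a_dx^d.\] In particular, all triangulations of $Q_G$ share the same $h$-vector. -/

import Mathlib

open scoped Pointwise

noncomputable section

namespace RootPolytope

section Triangulations

variable {W : Type*} [AddCommGroup W] [Module ℝ W]

/-- A triangulation of a polytope `Q`, given as a finite collection `T` of maximal simplices,
each encoded by its finite set of vertices. -/
structure IsTriangulation (Q : Set W) (T : Finset (Finset W)) : Prop where
  /-- the simplices are spanned by vertices of `Q` -/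
  subset_vertices : ∀ s ∈ T, (s : Set W) ⊆ Q.extremePoints ℝ
  /-- they are simplices -/
  affineIndependent : ∀ s ∈ T, AffineIndependent ℝ ((↑) : s → W)
  /-- they are maximal, that is, of the same dimension as `Q` -/
  affineSpan_eq : ∀ s ∈ T, affineSpan ℝ (s : Set W) = affineSpan ℝ Q
  /-- each two of them intersect in a common (possibly empty) face -/
  inter_face : ∀ s ∈ T, ∀ t ∈ T, ∃ u : Finset W, u ⊆ s ∧ u ⊆ t ∧
    convexHull ℝ (s : Set W) ∩ convexHull ℝ (t : Set W) = convexHull ℝ (u : Set W)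
  /-- their union is `Q` -/
  union_eq : ⋃ s ∈ T, convexHull ℝ (s : Set W) = Q

/-- The dimension of the simplicial complex generated by `T`. -/
def complexDim (T : Finset (Finset W)) : ℕ := T.sup Finset.card - 1

/-- The number `f_k` of `k`-dimensional simplices in the simplicial complex formed by the members
of `T` and all their faces. -/
def faceCount (T : Finset (Finset W)) (k : ℕ) : ℕ :=
  {u : Finset W | u.card = k + 1 ∧ ∃ s ∈ T, u ⊆ s}.ncard

/-- The `f`-vector `f(y) = y^{d+1} + f_0 y^d + f_1 y^{d-1} + ⋯ + f_d`, where `d` is the dimension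
of the complex. -/
def fVector (T : Finset (Finset W)) : Polynomial ℚ :=
  Polynomial.X ^ (complexDim T + 1) +
    ∑ k ∈ Finset.range (complexDim T + 1),
      Polynomial.C (faceCount T k : ℚ) * Polynomial.X ^ (complexDim T - k)

/-- The `h`-vector `h(x) = f(x - 1)`. -/
def hVector (T : Finset (Finset W)) : Polynomial ℚ :=
  (fVector T).comp (Polynomial.X - 1)

end Triangulations

section Graph

variable {E V : Type*} [DecidableEq E] [DecidableEq V]

/-- The root polytope of a bipartite graph with color classes `E` and `V`: the convex hull in
`ℝ^E ⊕ ℝ^V` of the vectors `i_e + i_v` for all edges `ev`. -/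
def rootPolytope (G : SimpleGraph (E ⊕ V)) : Set (E ⊕ V → ℝ) :=
  convexHull ℝ {p | ∃ (e : E) (v : V), G.Adj (Sum.inl e) (Sum.inr v) ∧
    p = Pi.single (Sum.inl e) 1 + Pi.single (Sum.inr v) 1}

/-- `ε_G(s)`, the number of lattice points in `s · Q_G`. -/
def ehrhart (G : SimpleGraph (E ⊕ V)) (s : ℕ) : ℕ :=
  {x : E ⊕ V → ℝ | x ∈ (s : ℝ) • rootPolytope G ∧ ∀ i, ∃ z : ℤ, x i = z}.ncard

/-- `a_0, …, a_d` are the coefficients of `ε_G` with respect to the binomial coefficients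
`C_k(s) = (s+d-k choose d)`. (Here `k ≤ d`, so the subtraction is never truncated.) -/
def IsEhrhartExpansion (G : SimpleGraph (E ⊕ V)) (d : ℕ) (a : Fin (d + 1) → ℚ) : Prop :=
  ∀ s : ℕ, (ehrhart G s : ℚ) = ∑ k : Fin (d + 1), a k * ((s + d - (k : ℕ)).choose d : ℚ)

end Graph

end RootPolytope

end

/-
Suppose that a simplicial complex `D` on the vertices of `Q` partitions the cone over `Q` into
relatively open unimodular simplicial cones. Then the lattice points of `s • Q` correspond to the
monomials of degree `s` whose support lies in `D`, so the Ehrhart series multiplied by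
`(1 - X) ^ (d + 1)` is `∑ F ∈ D, X ^ |F| * (1 - X) ^ (d + 1 - |F|)`. Its coefficients are the `a k`,
and for the faces of a triangulation it is `x ^ (d + 1) * h (1 / x)`. It has degree at most `d`
because `D` can be taken to be a pulling triangulation, which is a cone.

The simplices of a root polytope are unimodular: their vertices are the edges of a forest, while the
edges with a nonintegral coefficient in a lattice point would meet each touched vertex at least
twice.
-/

noncomputable section

namespace RootPolytope

section BinomialExpansions

open PowerSeries

variable {R : Type*} [CommRing R]

/-- The sequence `f` is the combination with coefficients `a₀, …, a_d` of the binomial coefficients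
`s ↦ (s+d-k choose d)`, `0 ≤ k ≤ d`. -/
def IsBinomialExpansion (f : ℕ → R) (d : ℕ) (a : Fin (d + 1) → R) : Prop :=
  ∀ s : ℕ, f s = ∑ k : Fin (d + 1), a k * ((s + d - (k : ℕ)).choose d : R)

theorem mk_choose_mul_one_sub_pow {k d : ℕ} (hk : k ≤ d) :
    (mk fun s ↦ ((s + d - k).choose d : R)) * (1 - X) ^ (d + 1) = X ^ k := by
  have shift : (mk fun s ↦ ((s + d - k).choose d : R)) =
      X ^ k * mk fun s ↦ ((d + s).choose d : R) := by
    ext s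
    rw [coeff_X_pow_mul', coeff_mk]
    split_ifs with hs
    · rw [coeff_mk]
      congr 2
      omega
    · rw [Nat.choose_eq_zero_of_lt (by omega), Nat.cast_zero]
  rw [shift, mul_assoc, mk_add_choose_mul_one_sub_pow_eq_one, mul_one]

theorem isUnit_one_sub_X_pow (n : ℕ) : IsUnit ((1 - X : R⟦X⟧) ^ n) :=
  (IsUnit.of_mul_eq_one_right _ (mk_one_mul_one_sub_eq_one R)).pow n

theorem isBinomialExpansion_iff [DecidableEq R] {f : ℕ → R} {d : ℕ} {a : Fin (d + 1) → R} :
    IsBinomialExpansion f d a ↔ mk f * (1 - X) ^ (d + 1) = (Polynomial.ofFn (d + 1) a : R⟦X⟧) := by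
  have expand : (Polynomial.ofFn (d + 1) a : R⟦X⟧) =
      (mk fun s ↦ ∑ k : Fin (d + 1), a k * ((s + d - (k : ℕ)).choose d : R)) *
        (1 - X) ^ (d + 1) := by
    have mk_sum : (mk fun s ↦ ∑ k : Fin (d + 1), a k * ((s + d - (k : ℕ)).choose d : R)) =
        ∑ k : Fin (d + 1), C (a k) * mk fun s ↦ ((s + d - (k : ℕ)).choose d : R) := by
      ext s
      simp [coeff_C_mul]
    rw [mk_sum, Finset.sum_mul, Polynomial.ofFn_eq_sum_monomial,
      ← Polynomial.coeToPowerSeries.ringHom_apply, map_sum]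
    refine Finset.sum_congr rfl fun k _ ↦ ?_
    rw [mul_assoc, mk_choose_mul_one_sub_pow (Nat.lt_succ_iff.1 k.2),
      ← Polynomial.C_mul_X_pow_eq_monomial]
    simp
  rw [expand, (isUnit_one_sub_X_pow (d + 1)).mul_left_inj, PowerSeries.ext_iff]
  simp only [IsBinomialExpansion, coeff_mk]

theorem existsUnique_isBinomialExpansion {f : ℕ → R} {d : ℕ} {p : Polynomial R}
    (hp : p.natDegree < d + 1) (hf : mk f * (1 - X) ^ (d + 1) = (p : R⟦X⟧)) :
    ∃! a, IsBinomialExpansion f d a := by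
  classical
  simp only [isBinomialExpansion_iff, hf, Polynomial.coe_inj]
  exact ⟨Polynomial.toFn (d + 1) p, (Polynomial.ofFn_comp_toFn_eq_id_of_natDegree_lt hp).symm,
    fun b hb ↦ by rw [hb, Polynomial.toFn_comp_ofFn_eq_id]⟩

end BinomialExpansions

theorem eq_of_forall_eval_inv_eq {K : Type*} [Field K] [Infinite K] {p q : Polynomial K}
    (h : ∀ x ≠ 0, p.eval x⁻¹ = q.eval x⁻¹) : p = q := by
  refine Polynomial.eq_of_infinite_eval_eq _ _ ((Set.finite_singleton 0).infinite_compl.mono ?_)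
  intro x hx
  have := h x⁻¹ (inv_ne_zero hx)
  rwa [inv_inv] at this

section Compositions

variable {ι : Type*} [DecidableEq ι]

/-- The ways of writing `n` as a sum of positive integers indexed by `F`, as finitely supported
functions with support exactly `F`. -/
def positiveCompositions (F : Finset ι) (n : ℕ) : Finset (ι →₀ ℕ) :=
  {m ∈ F.finsuppAntidiag n | m.support = F}

theorem mem_positiveCompositions {F : Finset ι} {n : ℕ} {m : ι →₀ ℕ} :
    m ∈ positiveCompositions F n ↔ m.support = F ∧ (m.sum fun _ k ↦ k) = n := by
  rw [positiveCompositions, Finset.mem_filter, Finset.mem_finsuppAntidiag']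
  aesop

open PowerSeries

theorem mk_card_positiveCompositions (R : Type*) [CommSemiring R] (F : Finset ι) :
    (mk fun n ↦ ((positiveCompositions F n).card : R)) = (X * mk 1) ^ F.card := by
  rw [← Finset.prod_const]
  ext n
  rw [coeff_prod, coeff_mk, positiveCompositions, Finset.card_filter, Nat.cast_sum]
  refine Finset.sum_congr rfl fun m hm ↦ ?_
  have hmF : m.support ⊆ F := (Finset.mem_finsuppAntidiag.1 hm).2
  have coeff_factor (k : ℕ) : coeff k (X * mk 1 : R⟦X⟧) = if k ≠ 0 then 1 else 0 := by
    cases k <;> simp [coeff_succ_X_mul]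
  have support_eq_iff : m.support = F ↔ ∀ i ∈ F, m i ≠ 0 :=
    ⟨fun h i hi ↦ Finsupp.mem_support_iff.1 (h ▸ hi),
      fun h ↦ hmF.antisymm fun i hi ↦ Finsupp.mem_support_iff.2 (h i hi)⟩
  simp only [coeff_factor, Finset.prod_ite_zero, Finset.prod_const_one, support_eq_iff,
    Nat.cast_ite, Nat.cast_one, Nat.cast_zero]

theorem mk_card_positiveCompositions_mul_one_sub_pow {R : Type*} [CommRing R] {F : Finset ι} {r : ℕ}
    (hF : F.card ≤ r) :
    (mk fun n ↦ ((positiveCompositions F n).card : R)) * (1 - X) ^ r =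
      X ^ F.card * (1 - X) ^ (r - F.card) := by
  rw [mk_card_positiveCompositions, ← pow_mul_pow_sub _ hF, ← mul_assoc, ← mul_pow, mul_assoc X,
    mk_one_mul_one_sub_eq_one, mul_one]

end Compositions

section ConePartitions

open Finsupp (linearCombination)

variable {ι W : Type*} [AddCommGroup W] [Module ℝ W] {v : ι → W}

theorem map_linearCombination_of_height_one {φ : W →ₗ[ℝ] ℝ} (hφ : ∀ i, φ (v i) = 1)
    (w : ι →₀ ℝ) : φ (linearCombination ℝ v w) = w.sum fun _ a ↦ a := by
  simp only [Finsupp.linearCombination_apply, Finsupp.sum, map_sum, map_smul, hφ, smul_eq_mul,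
    mul_one]

theorem height_linearCombination_nonneg {φ : W →ₗ[ℝ] ℝ} (hφ : ∀ i, φ (v i) = 1) {w : ι →₀ ℝ}
    (hw : 0 ≤ w) : 0 ≤ φ (linearCombination ℝ v w) := by
  rw [map_linearCombination_of_height_one hφ]
  exact Finset.sum_nonneg fun i _ ↦ hw i

theorem height_linearCombination_eq_zero_iff {φ : W →ₗ[ℝ] ℝ} (hφ : ∀ i, φ (v i) = 1)
    {w : ι →₀ ℝ} (hw : 0 ≤ w) : φ (linearCombination ℝ v w) = 0 ↔ w = 0 := by
  refine ⟨fun h ↦ ?_, fun h ↦ by rw [h, map_zero, map_zero]⟩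
  rw [map_linearCombination_of_height_one hφ] at h
  ext i
  by_contra hi
  exact hi ((Finset.sum_eq_zero_iff_of_nonneg fun i _ ↦ hw i).1 h i (Finsupp.mem_support_iff.2 hi))

theorem exists_of_mem_smul_convexHull {φ : W →ₗ[ℝ] ℝ} (hφ : ∀ i, φ (v i) = 1) {A : Set W}
    (hA : A ⊆ Set.range v) {t : ℝ} (ht : 0 ≤ t) {x : W} (hx : x ∈ t • convexHull ℝ A) :
    φ x = t ∧ ∃ w : ι →₀ ℝ, 0 ≤ w ∧ ↑w.support ⊆ v ⁻¹' A ∧ linearCombination ℝ v w = x := by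
  obtain ⟨y, hy, rfl⟩ := hx
  suffices h : φ y = 1 ∧
      ∃ w : ι →₀ ℝ, 0 ≤ w ∧ ↑w.support ⊆ v ⁻¹' A ∧ linearCombination ℝ v w = y by
    obtain ⟨hy1, w, hw0, hwA, rfl⟩ := h
    exact ⟨by simp [hy1], t • w, smul_nonneg ht hw0,
      (Finset.coe_subset.2 Finsupp.support_smul).trans hwA, map_smul _ t w⟩
  refine convexHull_min (t := {y | φ y = 1 ∧
    ∃ w : ι →₀ ℝ, 0 ≤ w ∧ ↑w.support ⊆ v ⁻¹' A ∧ linearCombination ℝ v w = y}) ?_ ?_ hy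
  · intro a ha
    obtain ⟨i, rfl⟩ := hA ha
    exact ⟨hφ i, Finsupp.single i 1, Finsupp.single_nonneg.2 zero_le_one,
      (Finset.coe_subset.2 Finsupp.support_single_subset).trans (by simpa using ha), by simp⟩
  · rintro _ ⟨h1, w, hw0, hwA, rfl⟩ _ ⟨h1', w', hw0', hwA', rfl⟩ a b ha hb hab
    refine ⟨by simp [h1, h1', hab], a • w + b • w',
      add_nonneg (smul_nonneg ha hw0) (smul_nonneg hb hw0'), ?_, by simp⟩
    classical
    refine (Finset.coe_subset.2 Finsupp.support_add).trans ?_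
    rw [Finset.coe_union]
    exact Set.union_subset ((Finset.coe_subset.2 Finsupp.support_smul).trans hwA)
      ((Finset.coe_subset.2 Finsupp.support_smul).trans hwA')

theorem linearCombination_mem_smul_convexHull {φ : W →ₗ[ℝ] ℝ} (hφ : ∀ i, φ (v i) = 1) {A : Set W}
    (hA : A.Nonempty) {w : ι →₀ ℝ} (hw : 0 ≤ w) (hwA : ↑w.support ⊆ v ⁻¹' A) :
    linearCombination ℝ v w ∈ φ (linearCombination ℝ v w) • convexHull ℝ A := by
  rcases (height_linearCombination_nonneg hφ hw).eq_or_lt with height_eq | height_pos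
  · rw [(height_linearCombination_eq_zero_iff hφ hw).1 height_eq.symm, map_zero, map_zero,
      Set.zero_smul_set (convexHull_nonempty_iff.2 hA)]
    exact Set.mem_zero.2 rfl
  · rw [map_linearCombination_of_height_one hφ] at height_pos ⊢
    exact ⟨w.support.centerMass w v, Finset.centerMass_mem_convexHull _ (fun i _ ↦ hw i) height_pos
      fun i hi ↦ hwA hi, smul_inv_smul₀ height_pos.ne' _⟩

/-- A vector configuration `v` is unimodular with respect to the lattice `L` if its vectors are in
`L` and every linearly independent subfamily of `v` generates the lattice points of its span. -/
structure IsUnimodular (v : ι → W) (L : AddSubgroup W) : Prop where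
  mem (i : ι) : v i ∈ L
  integral {c : ι →₀ ℝ} : LinearIndepOn ℝ v c.support → linearCombination ℝ v c ∈ L →
    ∀ i, ∃ k : ℤ, c i = k

/-- The family `D` partitions the cone generated by `v` into relatively open simplicial cones: each
point of the cone is a positive combination over exactly one member of `D`, in one way. -/
def IsConePartition (v : ι → W) (D : Finset (Finset ι)) : Prop :=
  ∀ w : ι →₀ ℝ, 0 ≤ w →
    ∃! c : ι →₀ ℝ, 0 ≤ c ∧ c.support ∈ D ∧ linearCombination ℝ v c = linearCombination ℝ v w

/-- The number of points of `L` in the dilate `s · Q`, or `0` if there are infinitely many. -/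
def latticePointCount (Q : Set W) (L : AddSubgroup W) (s : ℕ) : ℕ :=
  {x | x ∈ (s : ℝ) • Q ∧ x ∈ L}.ncard

variable {D : Finset (Finset ι)}

theorem IsConePartition.eq_of_linearCombination_eq (hD : IsConePartition v D) {c c' : ι →₀ ℝ}
    (hc : 0 ≤ c) (hc' : 0 ≤ c') (hcD : c.support ∈ D) (hcD' : c'.support ∈ D)
    (h : linearCombination ℝ v c = linearCombination ℝ v c') : c = c' :=
  (hD c' hc').unique ⟨hc, hcD, h⟩ ⟨hc', hcD', rfl⟩

theorem IsConePartition.linearIndepOn (hD : IsConePartition v D) {F : Finset ι} (hF : F ∈ D) :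
    LinearIndepOn ℝ v (F : Set ι) := by
  classical
  rw [linearIndepOn_iff]
  intro z hzF hz
  have hzF : z.support ⊆ F := Finset.coe_subset.1 ((Finsupp.mem_supported ℝ z).1 hzF)
  let b : ℝ := 1 + ∑ i ∈ F, |z i|
  have abs_lt (i : ι) (hi : i ∈ F) : |z i| < b :=
    (Finset.single_le_sum (fun j _ ↦ abs_nonneg (z j)) hi).trans_lt (lt_one_add _)
  have b_pos : 0 < b := add_pos_of_pos_of_nonneg one_pos (Finset.sum_nonneg fun i _ ↦ abs_nonneg _)
  let c : ι →₀ ℝ := Finsupp.indicator F fun _ _ ↦ b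
  have c_apply (i : ι) : c i = if i ∈ F then b else 0 := by simp [c, Finsupp.indicator_apply]
  have support_c : c.support = F := by ext i; simp [c_apply, b_pos.ne']
  have c_add_z_pos (i : ι) (hi : i ∈ F) : 0 < (c + z) i := by
    have := (_root_.abs_lt.1 (abs_lt i hi)).1
    rw [Finsupp.add_apply, c_apply, if_pos hi]
    linarith
  have c_add_z_eq_zero (i : ι) (hi : i ∉ F) : (c + z) i = 0 := by
    rw [Finsupp.add_apply, c_apply, if_neg hi, Finsupp.notMem_support_iff.1 fun h ↦ hi (hzF h),
      add_zero]
  have support_c_add_z : (c + z).support = F := by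
    ext i
    by_cases hi : i ∈ F
    · simp only [Finsupp.mem_support_iff, (c_add_z_pos i hi).ne', hi, ne_eq, not_false_iff]
    · simp only [Finsupp.mem_support_iff, c_add_z_eq_zero i hi, hi, ne_eq, not_true]
  have h : c + z = c := hD.eq_of_linearCombination_eq
    (fun i ↦ if hi : i ∈ F then (c_add_z_pos i hi).le else (c_add_z_eq_zero i hi).ge)
    (fun i ↦ by rw [c_apply]; split_ifs; exacts [b_pos.le, le_rfl])
    (support_c_add_z ▸ hF) (support_c ▸ hF) (by rw [map_add, hz, add_zero])
  exact left_eq_add.1 h.symm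

theorem IsUnimodular.comp {ι ι' W : Type*} [AddCommGroup W] [Module ℝ W] {v : ι → W}
    {L : AddSubgroup W} (hv : IsUnimodular v L) {f : ι' → ι} (hf : Function.Injective f) :
    IsUnimodular (v ∘ f) L where
  mem i := hv.mem (f i)
  integral {c} hc hcL i := by
    classical
    rw [← Finsupp.mapDomain_apply hf c i]
    refine hv.integral ?_ (by rwa [Finsupp.linearCombination_mapDomain]) (f i)
    rw [Finsupp.mapDomain_support_of_injective hf, Finset.coe_image]
    exact hc.image_of_comp f

theorem latticePoints_eq_image [DecidableEq ι] [Nonempty ι] (hD : IsConePartition v D)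
    {L : AddSubgroup W} (hv : IsUnimodular v L) {φ : W →ₗ[ℝ] ℝ} (hφ : ∀ i, φ (v i) = 1) (s : ℕ) :
    {x | x ∈ (s : ℝ) • convexHull ℝ (Set.range v) ∧ x ∈ L} =
      (fun m : ι →₀ ℕ ↦ linearCombination ℝ v (m.mapRange Nat.cast Nat.cast_zero)) ''
        (D.biUnion fun F ↦ positiveCompositions F s) := by
  ext x
  constructor
  · rintro ⟨hQ, hL⟩
    obtain ⟨hx, w, hw, -, rfl⟩ := exists_of_mem_smul_convexHull hφ subset_rfl s.cast_nonneg hQ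
    obtain ⟨c, ⟨hc, hcD, hcw⟩, -⟩ := hD w hw
    rw [← hcw] at hx hL ⊢
    have natural (i : ι) : ∃ k : ℕ, c i = k := by
      obtain ⟨k, hk⟩ := hv.integral (hD.linearIndepOn hcD) hL i
      have k_nonneg : 0 ≤ k := Int.cast_nonneg_iff.1 (hk ▸ hc i : (0 : ℝ) ≤ k)
      lift k to ℕ using k_nonneg
      exact ⟨k, by rw [hk, Int.cast_natCast]⟩
    obtain ⟨m, rfl⟩ : ∃ m : ι →₀ ℕ, m.mapRange Nat.cast Nat.cast_zero = c := by
      refine ⟨c.mapRange Nat.floor Nat.floor_zero, Finsupp.ext fun i ↦ ?_⟩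
      obtain ⟨k, hk⟩ := natural i
      rw [Finsupp.mapRange_apply, Finsupp.mapRange_apply, hk, Nat.floor_natCast]
    refine ⟨m, ?_, rfl⟩
    rw [Finsupp.support_mapRange_of_injective _ _ Nat.cast_injective] at hcD
    rw [map_linearCombination_of_height_one hφ, Finsupp.sum_mapRange_index fun _ ↦ rfl] at hx
    exact Finset.mem_coe.2 (Finset.mem_biUnion.2 ⟨_, hcD, mem_positiveCompositions.2
      ⟨rfl, by simpa [Finsupp.sum, ← Nat.cast_sum] using hx⟩⟩)
  · rintro ⟨m, hm, rfl⟩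
    obtain ⟨F, -, hmF⟩ := Finset.mem_biUnion.1 hm
    rw [mem_positiveCompositions] at hmF
    refine ⟨?_, ?_⟩
    · convert linearCombination_mem_smul_convexHull hφ (Set.range_nonempty v)
        (w := m.mapRange Nat.cast Nat.cast_zero) (fun i ↦ by simp) (by simp)
      rw [map_linearCombination_of_height_one hφ, Finsupp.sum_mapRange_index fun _ ↦ rfl]
      exact_mod_cast congrArg (Nat.cast : ℕ → ℝ) hmF.2.symm
    · refine AddSubgroup.sum_mem L fun i _ ↦ ?_
      change ((m i : ℕ) : ℝ) • v i ∈ L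
      exact Nat.cast_smul_eq_nsmul ℝ (m i) (v i) ▸ nsmul_mem (hv.mem i) _

theorem latticePointCount_eq [DecidableEq ι] [Nonempty ι] (hD : IsConePartition v D)
    {L : AddSubgroup W} (hv : IsUnimodular v L) {φ : W →ₗ[ℝ] ℝ} (hφ : ∀ i, φ (v i) = 1) (s : ℕ) :
    latticePointCount (convexHull ℝ (Set.range v)) L s =
      ∑ F ∈ D, (positiveCompositions F s).card := by
  have support_mem {m : ι →₀ ℕ} (hm : m ∈ D.biUnion fun F ↦ positiveCompositions F s) :
      (m.mapRange (Nat.cast : ℕ → ℝ) Nat.cast_zero).support ∈ D := by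
    rw [Finsupp.support_mapRange_of_injective _ _ Nat.cast_injective]
    obtain ⟨F, hF, hmF⟩ := Finset.mem_biUnion.1 hm
    exact (mem_positiveCompositions.1 hmF).1 ▸ hF
  rw [latticePointCount, latticePoints_eq_image hD hv hφ, Set.InjOn.ncard_image,
    Set.ncard_coe_finset, Finset.card_biUnion]
  · intro F _ F' _ hne
    refine Finset.disjoint_left.2 fun m hm hm' ↦ hne ?_
    rw [← (mem_positiveCompositions.1 hm).1, (mem_positiveCompositions.1 hm').1]
  · intro m hm m' hm' h
    exact Finsupp.mapRange_injective _ Nat.cast_zero Nat.cast_injective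
      (hD.eq_of_linearCombination_eq (fun i ↦ by simp) (fun i ↦ by simp)
        (support_mem hm) (support_mem hm') h)

/-- The `h`-polynomial of a simplicial complex `D` with faces of size at most `r`: the numerator of
the Hilbert series of its Stanley–Reisner ring over the denominator `(1 - X) ^ r`. -/
def hPolynomial (D : Finset (Finset ι)) (r : ℕ) : Polynomial ℚ :=
  ∑ F ∈ D, Polynomial.X ^ F.card * (1 - Polynomial.X) ^ (r - F.card)

theorem mk_latticePointCount_mul_one_sub_X_pow [Nonempty ι] (hD : IsConePartition v D)
    {L : AddSubgroup W} (hv : IsUnimodular v L) {φ : W →ₗ[ℝ] ℝ} (hφ : ∀ i, φ (v i) = 1) {r : ℕ}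
    (hr : ∀ F ∈ D, F.card ≤ r) :
    PowerSeries.mk (fun s ↦ (latticePointCount (convexHull ℝ (Set.range v)) L s : ℚ)) *
      (1 - PowerSeries.X) ^ r = (hPolynomial D r : PowerSeries ℚ) := by
  classical
  have mk_sum : PowerSeries.mk
        (fun s ↦ (latticePointCount (convexHull ℝ (Set.range v)) L s : ℚ)) =
      ∑ F ∈ D, PowerSeries.mk fun s ↦ ((positiveCompositions F s).card : ℚ) := by
    ext s
    simp [latticePointCount_eq hD hv hφ]
  rw [mk_sum, Finset.sum_mul, hPolynomial, ← Polynomial.coeToPowerSeries.ringHom_apply, map_sum]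
  refine Finset.sum_congr rfl fun F hF ↦ ?_
  rw [mk_card_positiveCompositions_mul_one_sub_pow (hr F hF)]
  simp

theorem finrank_span_image_of_linearIndepOn {F : Finset ι} (hF : LinearIndepOn ℝ v (F : Set ι)) :
    Module.finrank ℝ (Submodule.span ℝ (v '' F)) = F.card := by
  rw [Set.image_eq_range]
  exact (finrank_span_eq_card hF).trans (Fintype.card_coe F)

theorem IsConePartition.card_le_finrank [Finite ι] (hD : IsConePartition v D) {F : Finset ι}
    (hF : F ∈ D) :
    F.card ≤ Module.finrank ℝ (Submodule.span ℝ (Set.range v)) := by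
  have := FiniteDimensional.span_of_finite ℝ (Set.finite_range v)
  rw [← finrank_span_image_of_linearIndepOn (hD.linearIndepOn hF)]
  exact Submodule.finrank_mono (Submodule.span_mono (Set.image_subset_range v F))

end ConePartitions

section Cones

variable {ι : Type*}

theorem card_le_of_cone [DecidableEq ι] {D : Finset (Finset ι)} {d : ℕ} {i₀ : ι}
    (hcard : ∀ F ∈ D, F.card ≤ d + 1) (hcone : ∀ F, insert i₀ F ∈ D ↔ F ∈ D) {F : Finset ι}
    (hF : F ∈ D) (hi₀ : i₀ ∉ F) : F.card ≤ d := by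
  have := hcard _ ((hcone F).2 hF)
  rwa [Finset.card_insert_of_notMem hi₀, Nat.add_le_add_iff_right] at this

theorem hPolynomial_of_cone [DecidableEq ι] {D : Finset (Finset ι)} {d : ℕ} {i₀ : ι}
    (hcard : ∀ F ∈ D, F.card ≤ d + 1) (hcone : ∀ F, insert i₀ F ∈ D ↔ F ∈ D) :
    hPolynomial D (d + 1) = hPolynomial {F ∈ D | i₀ ∉ F} d := by
  have sum_mem : ∑ F ∈ D with ¬ i₀ ∉ F, (Polynomial.X ^ F.card *
      (1 - Polynomial.X) ^ (d + 1 - F.card) : Polynomial ℚ) =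
      ∑ F ∈ D with i₀ ∉ F, Polynomial.X ^ (F.card + 1) * (1 - Polynomial.X) ^ (d - F.card) := by
    refine Finset.sum_nbij' (fun F ↦ F.erase i₀) (fun F ↦ insert i₀ F) ?_ ?_ ?_ ?_ ?_
    · simp only [Finset.mem_filter, not_not, Finset.notMem_erase, not_false_iff, and_true]
      rintro F ⟨hF, hi₀⟩
      rwa [← hcone, Finset.insert_erase hi₀]
    · simp +contextual [hcone]
    · simp +contextual [Finset.insert_erase]
    · simp +contextual
    · simp only [Finset.mem_filter, not_not]
      rintro F ⟨-, hi₀⟩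
      rw [← Finset.card_erase_add_one hi₀, Nat.add_sub_add_right]
  rw [hPolynomial, ← Finset.sum_filter_add_sum_filter_not D (i₀ ∉ ·), sum_mem,
    ← Finset.sum_add_distrib, hPolynomial]
  refine Finset.sum_congr rfl fun F hF ↦ ?_
  obtain ⟨hF, hi₀⟩ := Finset.mem_filter.1 hF
  rw [Nat.sub_add_comm (card_le_of_cone hcard hcone hF hi₀)]
  ring

theorem natDegree_hPolynomial_le {D : Finset (Finset ι)} {r : ℕ} (hcard : ∀ F ∈ D, F.card ≤ r) :
    (hPolynomial D r).natDegree ≤ r := by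
  refine Polynomial.natDegree_sum_le_of_forall_le _ _ fun F hF ↦ ?_
  have : (1 - Polynomial.X : Polynomial ℚ).natDegree ≤ 1 := by compute_degree
  calc _ ≤ F.card + (r - F.card) * 1 := Polynomial.natDegree_mul_le_of_le
          (Polynomial.natDegree_X_pow_le _) (Polynomial.natDegree_pow_le_of_le _ this)
    _ = r := by have := hcard F hF; omega

end Cones

section LexComplex

open Finsupp (linearCombination)

theorem isClosed_setOf_map_eq {E W : Type*} [AddCommGroup E] [TopologicalSpace E]
    [IsTopologicalAddGroup E] [T2Space E] [Module ℝ E] [ContinuousSMul ℝ E] [FiniteDimensional ℝ E]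
    [AddCommGroup W] [Module ℝ W] (f : E →ₗ[ℝ] W) (y : W) : IsClosed {x | f x = y} := by
  rcases Set.eq_empty_or_nonempty {x | f x = y} with empty | ⟨a, rfl⟩
  · exact empty ▸ isClosed_empty
  · have eq_preimage : {x | f x = f a} = (fun x ↦ x - a) ⁻¹' (f.ker : Set E) := by
      ext x
      simp [sub_eq_zero]
    rw [eq_preimage]
    exact f.ker.closed_of_finiteDimensional.preimage (by fun_prop)

theorem exists_forall_toLex_le {ι α : Type*} [Finite ι] [LinearOrder ι] [LinearOrder α]
    [TopologicalSpace α] [OrderClosedTopology α] {K : Set (ι → α)} (hK : IsCompact K)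
    (hne : K.Nonempty) : ∃ c ∈ K, ∀ c' ∈ K, toLex c' ≤ toLex c := by
  have key (s : Finset ι) : ∃ K' ⊆ K, IsCompact K' ∧ K'.Nonempty ∧ ∀ c ∈ K', ∀ c' ∈ K,
      ((∀ j ∈ s, c' j = c j) → c' ∈ K') ∧
        ∀ i ∈ s, (∀ j ∈ s, j < i → c' j = c j) → c' i ≤ c i := by
    induction s using Finset.induction_on_max with
    | empty => exact ⟨K, subset_rfl, hK, hne, fun c _ c' hc' ↦ ⟨fun _ ↦ hc', by simp⟩⟩
    | insert i s hi ih =>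
      obtain ⟨K', hK'K, hK', hne', h⟩ := ih
      obtain ⟨c₀, hc₀, hmax⟩ := hK'.exists_isMaxOn hne' (continuous_apply i).continuousOn
      refine ⟨K' ∩ {c | c₀ i ≤ c i}, Set.inter_subset_left.trans hK'K,
        hK'.inter_right (isClosed_le continuous_const (continuous_apply i)), ⟨c₀, hc₀, le_rfl⟩, ?_⟩
      rintro c ⟨hc, hci⟩ c' hc'
      refine ⟨fun agree ↦ ?_, fun k hk agree ↦ ?_⟩
      · exact ⟨(h c hc c' hc').1 fun j hj ↦ agree j (Finset.mem_insert_of_mem hj),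
          hci.trans (agree i (Finset.mem_insert_self i s)).ge⟩
      · rcases Finset.mem_insert.1 hk with rfl | hk
        · exact (hmax ((h c hc c' hc').1
            fun j hj ↦ agree j (Finset.mem_insert_of_mem hj) (hi j hj))).trans hci
        · exact (h c hc c' hc').2 k hk fun j hj ↦ agree j (Finset.mem_insert_of_mem hj)
  have := Fintype.ofFinite ι
  obtain ⟨K', hK'K, -, ⟨c, hc⟩, h⟩ := key Finset.univ
  refine ⟨c, hK'K hc, fun c' hc' ↦ not_lt.1 fun ⟨i, agree, hi⟩ ↦ ?_⟩
  exact hi.not_ge ((h c hc c' hc').2 i (Finset.mem_univ i) fun j _ hj ↦ (agree j hj).symm)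

variable {ι W : Type*} [AddCommGroup W] [Module ℝ W] {v : ι → W}

section LinearOrder

variable [LinearOrder ι]

theorem exists_toLex_max [Finite ι] {φ : W →ₗ[ℝ] ℝ} (hφ : ∀ i, φ (v i) = 1) {w : ι →₀ ℝ}
    (hw : 0 ≤ w) : ∃ c : ι →₀ ℝ, 0 ≤ c ∧ linearCombination ℝ v c = linearCombination ℝ v w ∧
      ∀ c' : ι →₀ ℝ, 0 ≤ c' → linearCombination ℝ v c' = linearCombination ℝ v w →
        toLex c' ≤ toLex c := by
  have := Fintype.ofFinite ι
  let e := (Finsupp.linearEquivFunOnFinite ℝ ℝ ι).symm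
  let K : Set (ι → ℝ) := {c | 0 ≤ c ∧ linearCombination ℝ v (e c) = linearCombination ℝ v w}
  have K_bounded : K ⊆ Set.Icc 0 fun _ ↦ φ (linearCombination ℝ v w) := by
    rintro c ⟨hc, hcw⟩
    refine ⟨hc, fun i ↦ ?_⟩
    rw [← hcw, map_linearCombination_of_height_one hφ, Finsupp.sum_fintype _ _ fun _ ↦ rfl]
    exact Finset.single_le_sum (fun j _ ↦ hc j) (Finset.mem_univ i)
  have K_closed : IsClosed K :=
    isClosed_Ici.inter (isClosed_setOf_map_eq (linearCombination ℝ v ∘ₗ e.toLinearMap) _)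
  obtain ⟨c, ⟨hc, hcw⟩, hmax⟩ :=
    exists_forall_toLex_le (isCompact_Icc.of_isClosed_subset K_closed K_bounded)
      ⟨w, hw, congrArg (linearCombination ℝ v) (e.apply_symm_apply w)⟩
  exact ⟨e c, hc, hcw, fun c' hc' h ↦
    hmax c' ⟨hc', (congrArg (linearCombination ℝ v) (e.apply_symm_apply c')).trans h⟩⟩

variable [Fintype ι]

open scoped Classical in
/-- The pulling triangulation of the configuration `v` with respect to the order of `ι`, whose faces
are the supports of the lexicographically maximal nonnegative combinations. It is encoded by its
nonfaces, which are the sets containing the negative part `{i | z i < 0}` of some lexicographically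
positive linear relation `z`. -/
def lexComplex (v : ι → W) : Finset (Finset ι) :=
  {F | ∀ z : ι →₀ ℝ, linearCombination ℝ v z = 0 → 0 < toLex z → ∃ i ∉ F, z i < 0}

theorem mem_lexComplex {F : Finset ι} : F ∈ lexComplex v ↔
    ∀ z : ι →₀ ℝ, linearCombination ℝ v z = 0 → 0 < toLex z → ∃ i ∉ F, z i < 0 := by
  simp [lexComplex]

theorem toLex_le_of_support_mem_lexComplex {c c' : ι →₀ ℝ} (hc : c.support ∈ lexComplex v)
    (hc' : 0 ≤ c') (h : linearCombination ℝ v c' = linearCombination ℝ v c) :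
    toLex c' ≤ toLex c := by
  by_contra! hlt
  obtain ⟨i, hi, hneg⟩ := mem_lexComplex.1 hc (c' - c) (by rw [map_sub, h, sub_self])
    (by rw [toLex_sub]; exact sub_pos.2 hlt)
  rw [Finsupp.sub_apply, Finsupp.notMem_support_iff.1 hi, sub_zero] at hneg
  exact hneg.not_ge (hc' i)

theorem support_mem_lexComplex {c : ι →₀ ℝ} (hc : 0 ≤ c)
    (hmax : ∀ c' : ι →₀ ℝ, 0 ≤ c' → linearCombination ℝ v c' = linearCombination ℝ v c →
      toLex c' ≤ toLex c) : c.support ∈ lexComplex v := by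
  refine mem_lexComplex.2 fun z hz hpos ↦ ?_
  by_contra! hneg
  have eventually_nonneg (i : ι) : ∀ᶠ ε : ℝ in nhdsWithin 0 (Set.Ioi 0), 0 ≤ c i + ε * z i := by
    by_cases hi : i ∈ c.support
    · have hci : 0 < c i := (hc i).lt_of_ne' (Finsupp.mem_support_iff.1 hi)
      have tendsto : Filter.Tendsto (fun ε : ℝ ↦ c i + ε * z i) (nhds 0) (nhds (c i)) :=
        Continuous.tendsto' (by fun_prop) _ _ (by simp)
      exact nhdsWithin_le_nhds ((tendsto.eventually (lt_mem_nhds hci)).mono fun ε hε ↦ hε.le)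
    · filter_upwards [self_mem_nhdsWithin] with ε hε
      exact add_nonneg (hc i) (mul_nonneg (le_of_lt hε) (hneg i hi))
  obtain ⟨ε, hε, ε_pos⟩ :=
    ((Filter.eventually_all.2 eventually_nonneg).and self_mem_nhdsWithin).exists
  have smul_pos : 0 < toLex (ε • z) :=
    let ⟨i, zero_of_lt, hi⟩ := hpos
    ⟨i, fun j hj ↦ (mul_eq_zero_of_right ε (zero_of_lt j hj).symm).symm, mul_pos ε_pos hi⟩
  exact (hmax (c + ε • z) hε (by simp [hz])).not_gt (lt_add_of_pos_right (toLex c) smul_pos)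

theorem isConePartition_lexComplex {φ : W →ₗ[ℝ] ℝ} (hφ : ∀ i, φ (v i) = 1) :
    IsConePartition v (lexComplex v) := by
  intro w hw
  obtain ⟨c, hc, hcw, hmax⟩ := exists_toLex_max hφ hw
  refine ⟨c, ⟨hc, support_mem_lexComplex hc fun c' hc' h ↦ hmax c' hc' (h.trans hcw), hcw⟩, ?_⟩
  rintro c' ⟨hc', hcD', h⟩
  exact toLex_inj.1 ((hmax c' hc' h).antisymm
    (toLex_le_of_support_mem_lexComplex hcD' hc (hcw.trans h.symm)))

theorem insert_mem_lexComplex_iff {i₀ : ι} (hi₀ : ∀ i, i₀ ≤ i) {F : Finset ι} :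
    insert i₀ F ∈ lexComplex v ↔ F ∈ lexComplex v := by
  simp only [mem_lexComplex]
  refine forall₃_congr fun z _ hpos ↦ ?_
  have nonneg : 0 ≤ z i₀ := by
    obtain ⟨i, zero_of_lt, hi⟩ := hpos
    rcases (hi₀ i).eq_or_lt with rfl | hlt
    · exact le_of_lt hi
    · exact (zero_of_lt i₀ hlt).le
  refine exists_congr fun i ↦ ?_
  rw [Finset.mem_insert, not_or]
  exact ⟨fun h ↦ ⟨h.1.2, h.2⟩, fun h ↦ ⟨⟨fun hi ↦ (hi ▸ h.2).not_ge nonneg, h.1⟩, h.2⟩⟩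

end LinearOrder

theorem existsUnique_isBinomialExpansion_latticePointCount [Finite ι] [Nonempty ι]
    {L : AddSubgroup W} (hv : IsUnimodular v L) {φ : W →ₗ[ℝ] ℝ} (hφ : ∀ i, φ (v i) = 1) {d : ℕ}
    (hd : Module.finrank ℝ (Submodule.span ℝ (Set.range v)) = d + 1) :
    ∃! a : Fin (d + 1) → ℚ,
      IsBinomialExpansion
        (fun s ↦ (latticePointCount (convexHull ℝ (Set.range v)) L s : ℚ)) d a := by
  obtain ⟨_, -⟩ := exists_wellFoundedLT ι
  have := Fintype.ofFinite ι
  obtain ⟨i₀, hi₀⟩ := Finite.exists_min (id : ι → ι)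
  have hD := isConePartition_lexComplex hφ
  have card_le (F : Finset ι) (hF : F ∈ lexComplex v) : F.card ≤ d + 1 :=
    (hD.card_le_finrank hF).trans_eq hd
  have cone (F : Finset ι) : insert i₀ F ∈ lexComplex v ↔ F ∈ lexComplex v :=
    insert_mem_lexComplex_iff hi₀
  refine existsUnique_isBinomialExpansion ?_
    (mk_latticePointCount_mul_one_sub_X_pow hD hv hφ card_le)
  rw [hPolynomial_of_cone card_le cone]
  refine Nat.lt_succ_of_le (natDegree_hPolynomial_le fun F hF ↦ ?_)
  obtain ⟨hF, hi₀F⟩ := Finset.mem_filter.1 hF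
  exact card_le_of_cone card_le cone hF hi₀F

end LexComplex

section Triangulations

open Finsupp (linearCombination)

variable {ι W : Type*} [AddCommGroup W] [Module ℝ W] {v : ι → W}

theorem linearIndependent_of_affineIndependent {φ : W →ₗ[ℝ] ℝ} (hφ : ∀ i, φ (v i) = 1)
    (hv : AffineIndependent ℝ v) : LinearIndependent ℝ v := by
  rw [linearIndependent_iff']
  intro s g hg
  refine affineIndependent_iff.1 hv s g ?_ hg
  simpa [hφ] using congrArg φ hg

namespace IsTriangulation

variable {T : Finset (Finset W)} {φ : W →ₗ[ℝ] ℝ}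

theorem subset_range (hT : IsTriangulation (convexHull ℝ (Set.range v)) T) {s : Finset W}
    (hs : s ∈ T) : (s : Set W) ⊆ Set.range v :=
  (hT.subset_vertices s hs).trans extremePoints_convexHull_subset

theorem linearIndepOn_id (hT : IsTriangulation (convexHull ℝ (Set.range v)) T)
    (hφ : ∀ i, φ (v i) = 1) {s : Finset W} (hs : s ∈ T) : LinearIndepOn ℝ id (s : Set W) :=
  linearIndependent_of_affineIndependent (φ := φ)
    (fun x ↦ by obtain ⟨i, hi⟩ := hT.subset_range hs x.2; exact hi ▸ hφ i)
    (hT.affineIndependent s hs)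

theorem linearIndepOn_preimage (hT : IsTriangulation (convexHull ℝ (Set.range v)) T)
    (hv : Function.Injective v) (hφ : ∀ i, φ (v i) = 1) {s : Finset W} (hs : s ∈ T) :
    LinearIndepOn ℝ v (v ⁻¹' s) := by
  let e : v ⁻¹' (s : Set W) ↪ (s : Set W) :=
    ⟨fun i ↦ ⟨v i, i.2⟩, fun _ _ h ↦ Subtype.ext (hv (congrArg Subtype.val h))⟩
  exact linearIndependent_of_affineIndependent (fun i ↦ hφ i)
    ((hT.affineIndependent s hs).comp_embedding e)

theorem card_eq_finrank (hT : IsTriangulation (convexHull ℝ (Set.range v)) T)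
    (hφ : ∀ i, φ (v i) = 1) {s : Finset W} (hs : s ∈ T) :
    s.card = Module.finrank ℝ (Submodule.span ℝ (Set.range v)) := by
  rw [← finrank_span_finset_eq_card (hT.linearIndepOn_id hφ hs)]
  have h := hT.affineSpan_eq s hs
  rw [affineSpan_convexHull] at h
  have range_subset : Set.range v ⊆ Submodule.span ℝ (s : Set W) :=
    (subset_affineSpan ℝ _).trans (h ▸ affineSpan_subset_span)
  rw [(Submodule.span_mono (hT.subset_range hs)).antisymm (Submodule.span_le.2 range_subset)]

theorem nonempty [Nonempty ι] (hT : IsTriangulation (convexHull ℝ (Set.range v)) T) :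
    T.Nonempty := by
  by_contra! h
  have := hT.union_eq
  simp only [h, Finset.notMem_empty, Set.iUnion_of_empty, Set.iUnion_empty] at this
  exact (convexHull_nonempty_iff.2 (Set.range_nonempty v)).ne_empty this.symm

theorem complexDim_eq [Nonempty ι] (hT : IsTriangulation (convexHull ℝ (Set.range v)) T)
    (hφ : ∀ i, φ (v i) = 1) {d : ℕ}
    (hd : Module.finrank ℝ (Submodule.span ℝ (Set.range v)) = d + 1) : complexDim T = d := by
  rw [complexDim, Finset.sup_congr rfl fun s hs ↦ (hT.card_eq_finrank hφ hs).trans hd,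
    Finset.sup_const hT.nonempty, Nat.add_sub_cancel]

end IsTriangulation

open scoped Classical in
/-- The complex of all faces of the simplices in `T`, each given as the set of the indices of its
vertices in the configuration `v`. -/
def faceComplex {ι W : Type*} [Fintype ι] (v : ι → W) (T : Finset (Finset W)) : Finset (Finset ι) :=
  {F | ∃ s ∈ T, ∀ i ∈ F, v i ∈ s}

theorem mem_faceComplex {ι W : Type*} [Fintype ι] {v : ι → W} {T : Finset (Finset W)}
    {F : Finset ι} : F ∈ faceComplex v T ↔ ∃ s ∈ T, (F : Set ι) ⊆ v ⁻¹' s := by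
  simp [faceComplex, Set.subset_def]

namespace IsTriangulation

variable [Fintype ι] {T : Finset (Finset W)} {φ : W →ₗ[ℝ] ℝ}

theorem eq_of_linearCombination_eq (hT : IsTriangulation (convexHull ℝ (Set.range v)) T)
    (hv : Function.Injective v) (hφ : ∀ i, φ (v i) = 1) {c c' : ι →₀ ℝ} (hc : 0 ≤ c) (hc' : 0 ≤ c')
    (hcT : c.support ∈ faceComplex v T) (hcT' : c'.support ∈ faceComplex v T)
    (h : linearCombination ℝ v c = linearCombination ℝ v c') : c = c' := by
  obtain ⟨s, hs, hcs⟩ := mem_faceComplex.1 hcT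
  obtain ⟨t, ht, hct⟩ := mem_faceComplex.1 hcT'
  by_cases height_eq : φ (linearCombination ℝ v c) = 0
  · rw [(height_linearCombination_eq_zero_iff hφ hc).1 height_eq,
      (height_linearCombination_eq_zero_iff hφ hc').1 (h ▸ height_eq)]
  have nonempty_of_support_subset {c : ι →₀ ℝ} {s : Finset W}
      (hcs : (c.support : Set ι) ⊆ v ⁻¹' s) (hc : φ (linearCombination ℝ v c) ≠ 0) :
      (s : Set W).Nonempty := by
    have c_ne_zero : c ≠ 0 := by rintro rfl; simp at hc
    obtain ⟨i, hi⟩ := Finsupp.support_nonempty_iff.2 c_ne_zero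
    exact ⟨v i, hcs hi⟩
  have mem_s := linearCombination_mem_smul_convexHull hφ
    (nonempty_of_support_subset hcs height_eq) hc hcs
  have mem_t := linearCombination_mem_smul_convexHull hφ
    (nonempty_of_support_subset hct (h ▸ height_eq)) hc' hct
  obtain ⟨u, hus, hut, inter_eq⟩ := hT.inter_face s hs t ht
  have mem_u : linearCombination ℝ v c ∈
      φ (linearCombination ℝ v c) • convexHull ℝ (u : Set W) := by
    rw [← inter_eq, Set.smul_set_inter₀ height_eq]
    exact ⟨mem_s, h ▸ mem_t⟩
  have u_subset := (Finset.coe_subset.2 hus).trans (hT.subset_range hs)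
  obtain ⟨-, w, -, hwu, hw⟩ := exists_of_mem_smul_convexHull hφ u_subset
    (height_linearCombination_nonneg hφ hc) mem_u
  have hws : ↑w.support ⊆ v ⁻¹' s := hwu.trans (Set.preimage_mono (Finset.coe_subset.2 hus))
  have hwt : ↑w.support ⊆ v ⁻¹' t := hwu.trans (Set.preimage_mono (Finset.coe_subset.2 hut))
  exact (linearIndepOn_iffₛ.1 (hT.linearIndepOn_preimage hv hφ hs) c hcs w hws hw.symm).trans
    (linearIndepOn_iffₛ.1 (hT.linearIndepOn_preimage hv hφ ht) w hwt c' hct (hw.trans h))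

theorem isConePartition_faceComplex [Nonempty ι]
    (hT : IsTriangulation (convexHull ℝ (Set.range v)) T)
    (hv : Function.Injective v) (hφ : ∀ i, φ (v i) = 1) :
    IsConePartition v (faceComplex v T) := by
  intro w hw
  have height_nonneg := height_linearCombination_nonneg hφ hw
  have mem_dilate := linearCombination_mem_smul_convexHull hφ (Set.range_nonempty v) hw (by simp)
  rw [← hT.union_eq] at mem_dilate
  obtain ⟨s, hs, c, hc, hcs, hcw⟩ : ∃ s ∈ T, ∃ c : ι →₀ ℝ, 0 ≤ c ∧ ↑c.support ⊆ v ⁻¹' s ∧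
      linearCombination ℝ v c = linearCombination ℝ v w := by
    obtain ⟨y, hy, hyw⟩ := mem_dilate
    obtain ⟨s, hs, hys⟩ := Set.mem_iUnion₂.1 hy
    exact ⟨s, hs, (exists_of_mem_smul_convexHull hφ (hT.subset_range hs) height_nonneg
      ⟨y, hys, hyw⟩).2⟩
  have hcT : c.support ∈ faceComplex v T := mem_faceComplex.2 ⟨s, hs, hcs⟩
  exact ⟨c, ⟨hc, hcT, hcw⟩, fun c' ⟨hc', hcT', hcw'⟩ ↦
    hT.eq_of_linearCombination_eq hv hφ hc' hc hcT' hcT (hcw'.trans hcw.symm)⟩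

theorem card_le_of_mem_faceComplex (hT : IsTriangulation (convexHull ℝ (Set.range v)) T)
    (hv : Function.Injective v) (hφ : ∀ i, φ (v i) = 1) {F : Finset ι} (hF : F ∈ faceComplex v T) :
    F.card ≤ Module.finrank ℝ (Submodule.span ℝ (Set.range v)) := by
  obtain ⟨s, hs, hFs⟩ := mem_faceComplex.1 hF
  rw [← hT.card_eq_finrank hφ hs]
  exact Finset.card_le_card_of_injOn v hFs hv.injOn

theorem faceCount_eq (hT : IsTriangulation (convexHull ℝ (Set.range v)) T)
    (hv : Function.Injective v) (k : ℕ) :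
    faceCount T k = (Finset.card {F ∈ faceComplex v T | F.card = k + 1}) := by
  have faces_eq_image : {u : Finset W | u.card = k + 1 ∧ ∃ s ∈ T, u ⊆ s} =
      Finset.map ⟨v, hv⟩ '' ({F ∈ faceComplex v T | F.card = k + 1} : Finset (Finset ι)) := by
    ext u
    constructor
    · rintro ⟨hu, s, hs, hus⟩
      obtain ⟨F, rfl⟩ : ∃ F : Finset ι, F.map ⟨v, hv⟩ = u := by
        refine ⟨u.preimage v hv.injOn, Finset.coe_injective ?_⟩
        rw [Finset.coe_map, Finset.coe_preimage]
        exact Set.image_preimage_eq_of_subset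
          ((Finset.coe_subset.2 hus).trans (hT.subset_range hs))
      rw [Finset.card_map] at hu
      refine ⟨F, Finset.mem_coe.2 (Finset.mem_filter.2 ⟨mem_faceComplex.2 ⟨s, hs, ?_⟩, hu⟩), rfl⟩
      exact fun i hi ↦ hus (Finset.mem_map_of_mem _ hi)
    · rintro ⟨F, hF, rfl⟩
      obtain ⟨hF, hFk⟩ := Finset.mem_filter.1 (Finset.mem_coe.1 hF)
      obtain ⟨s, hs, hFs⟩ := mem_faceComplex.1 hF
      refine ⟨(Finset.card_map _).trans hFk, s, hs, fun x hx ↦ ?_⟩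
      obtain ⟨i, hi, rfl⟩ := Finset.mem_map.1 hx
      exact hFs hi
  rw [faceCount, faces_eq_image, Set.ncard_image_of_injective _ (Finset.map_injective _),
    Set.ncard_coe_finset]

theorem fVector_eq [Nonempty ι] (hT : IsTriangulation (convexHull ℝ (Set.range v)) T)
    (hv : Function.Injective v) (hφ : ∀ i, φ (v i) = 1) {d : ℕ}
    (hd : Module.finrank ℝ (Submodule.span ℝ (Set.range v)) = d + 1) :
    fVector T = ∑ F ∈ faceComplex v T, Polynomial.X ^ (d + 1 - F.card) := by
  have card_mem (F : Finset ι) (hF : F ∈ faceComplex v T) : F.card ∈ Finset.range (d + 2) :=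
    Finset.mem_range_succ_iff.2 ((hT.card_le_of_mem_faceComplex hv hφ hF).trans_eq hd)
  have empty_face : ({F ∈ faceComplex v T | F.card = 0} : Finset (Finset ι)) = {∅} := by
    obtain ⟨s, hs⟩ := hT.nonempty
    ext F
    rw [Finset.mem_filter, Finset.card_eq_zero, Finset.mem_singleton, and_iff_right_iff_imp]
    rintro rfl
    exact mem_faceComplex.2 ⟨s, hs, by simp⟩
  rw [fVector, hT.complexDim_eq hφ hd, ← Finset.sum_fiberwise_of_maps_to card_mem,
    Finset.sum_range_succ' _ (d + 1), empty_face, Finset.sum_singleton, add_comm]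
  congr 1
  refine Finset.sum_congr rfl fun k _ ↦ ?_
  rw [Finset.sum_congr rfl fun F hF ↦ by rw [(Finset.mem_filter.1 hF).2, Nat.add_sub_add_right],
    Finset.sum_const, hT.faceCount_eq hv, nsmul_eq_mul, Polynomial.C_eq_natCast]

theorem pow_mul_eval_hVector [Nonempty ι] (hT : IsTriangulation (convexHull ℝ (Set.range v)) T)
    (hv : Function.Injective v) (hφ : ∀ i, φ (v i) = 1) {d : ℕ}
    (hd : Module.finrank ℝ (Submodule.span ℝ (Set.range v)) = d + 1) {x : ℚ} (hx : x ≠ 0) :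
    x ^ (d + 1) * (hVector T).eval x⁻¹ = (hPolynomial (faceComplex v T) (d + 1)).eval x := by
  rw [hVector, hT.fVector_eq hv hφ hd, hPolynomial, Polynomial.eval_comp,
    Polynomial.eval_finsetSum, Polynomial.eval_finsetSum, Finset.mul_sum]
  refine Finset.sum_congr rfl fun F hF ↦ ?_
  have card_le := (hT.card_le_of_mem_faceComplex hv hφ hF).trans_eq hd
  simp only [Polynomial.eval_pow, Polynomial.eval_mul, Polynomial.eval_sub, Polynomial.eval_X,
    Polynomial.eval_one]
  rw [← pow_mul_pow_sub x card_le, mul_assoc, ← mul_pow, mul_sub, mul_inv_cancel₀ hx, mul_one]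

theorem pow_mul_eval_hVector_eq_sum {ι : Type*} [Finite ι] [Nonempty ι] {v : ι → W}
    (hT : IsTriangulation (convexHull ℝ (Set.range v)) T)
    (hv : Function.Injective v) (hφ : ∀ i, φ (v i) = 1) {L : AddSubgroup W}
    (hL : IsUnimodular v L) {d : ℕ}
    (hd : Module.finrank ℝ (Submodule.span ℝ (Set.range v)) = d + 1) {a : Fin (d + 1) → ℚ}
    (ha : IsBinomialExpansion
      (fun s ↦ (latticePointCount (convexHull ℝ (Set.range v)) L s : ℚ)) d a)
    {x : ℚ} (hx : x ≠ 0) :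
    x ^ (d + 1) * (hVector T).eval x⁻¹ = ∑ k : Fin (d + 1), a k * x ^ (k : ℕ) := by
  have := Fintype.ofFinite ι
  have hPolynomial_eq : hPolynomial (faceComplex v T) (d + 1) = Polynomial.ofFn (d + 1) a := by
    rw [← Polynomial.coe_inj, ← isBinomialExpansion_iff.1 ha,
      mk_latticePointCount_mul_one_sub_X_pow (hT.isConePartition_faceComplex hv hφ) hL hφ
        fun F hF ↦ (hT.card_le_of_mem_faceComplex hv hφ hF).trans_eq hd]
  rw [hT.pow_mul_eval_hVector hv hφ hd hx, hPolynomial_eq, Polynomial.ofFn_eq_sum_monomial,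
    Polynomial.eval_finsetSum]
  exact Finset.sum_congr rfl fun k _ ↦ Polynomial.eval_monomial

end IsTriangulation

end Triangulations

section RootPolytopes

open Finsupp (linearCombination)

theorem one_lt_card_filter_notMem_of_sum_mem {ι M : Type*} [AddCommGroup M] {H : AddSubgroup M}
    {s : Finset ι} {c : ι → M} [DecidablePred (c · ∉ H)] (hsum : ∑ i ∈ s, c i ∈ H) {p : ι}
    (hp : p ∈ s) (hcp : c p ∉ H) : 1 < Finset.card {i ∈ s | c i ∉ H} := by
  classical
  by_contra! card_le_one
  have mem_of_ne (i : ι) (hi : i ∈ s.erase p) : c i ∈ H := by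
    by_contra hci
    obtain ⟨hne, his⟩ := Finset.mem_erase.1 hi
    exact hne (Finset.card_le_one.1 card_le_one i (Finset.mem_filter.2 ⟨his, hci⟩) p
      (Finset.mem_filter.2 ⟨hp, hcp⟩))
  rw [← Finset.add_sum_erase s c hp, H.add_mem_cancel_right (sum_mem mem_of_ne)] at hsum
  exact hcp hsum

theorem two_mul_card_image_filter_notMem_le {ι κ M : Type*} [DecidableEq κ] [AddCommGroup M]
    {H : AddSubgroup M} {s : Finset ι} {c : ι → M} [DecidablePred (c · ∉ H)] {f : ι → κ}
    (hsum : ∀ b, ∑ i ∈ s with f i = b, c i ∈ H) :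
    2 * (Finset.image f {i ∈ s | c i ∉ H}).card ≤ Finset.card {i ∈ s | c i ∉ H} := by
  refine Finset.mul_card_image_le_card _ 2 fun b hb ↦ ?_
  obtain ⟨p, hp, rfl⟩ := Finset.mem_image.1 hb
  obtain ⟨hps, hcp⟩ := Finset.mem_filter.1 hp
  rw [Finset.filter_comm]
  exact one_lt_card_filter_notMem_of_sum_mem (hsum (f p)) (Finset.mem_filter.2 ⟨hps, rfl⟩) hcp

/-- The lattice of the points with integer coordinates. -/
def integerLattice (κ : Type*) : AddSubgroup (κ → ℝ) :=
  AddSubgroup.pi Set.univ fun _ ↦ (Int.castAddHom ℝ).range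

theorem mem_integerLattice {κ : Type*} {x : κ → ℝ} :
    x ∈ integerLattice κ ↔ ∀ i, x i ∈ (Int.castAddHom ℝ).range := by
  simp [integerLattice, AddSubgroup.mem_pi]

variable {E V : Type*} [DecidableEq E] [DecidableEq V]

/-- The vertex `i_e + i_v` of the root polytope of the complete bipartite graph. -/
def edgeVector (p : E × V) : E ⊕ V → ℝ :=
  Pi.single (Sum.inl p.1) 1 + Pi.single (Sum.inr p.2) 1

theorem edgeVector_inl (p : E × V) (e : E) :
    edgeVector p (Sum.inl e) = if p.1 = e then 1 else 0 := by
  simp [edgeVector, Pi.single_apply, eq_comm]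

theorem edgeVector_inr (p : E × V) (v : V) :
    edgeVector p (Sum.inr v) = if p.2 = v then 1 else 0 := by
  simp [edgeVector, Pi.single_apply, eq_comm]

theorem edgeVector_injective : Function.Injective (edgeVector : E × V → E ⊕ V → ℝ) := by
  intro p q h
  have left := congrFun h (Sum.inl q.1)
  have right := congrFun h (Sum.inr q.2)
  simp only [edgeVector_inl, edgeVector_inr, if_true, ite_eq_left_iff, zero_ne_one, imp_false,
    not_not] at left right
  exact Prod.ext left right

theorem linearCombination_edgeVector_inl (c : E × V →₀ ℝ) (e : E) :
    linearCombination ℝ edgeVector c (Sum.inl e) = ∑ p ∈ c.support with p.1 = e, c p := by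
  simp [Finsupp.linearCombination_apply, Finsupp.sum, edgeVector_inl, Finset.sum_filter]

theorem linearCombination_edgeVector_inr (c : E × V →₀ ℝ) (v : V) :
    linearCombination ℝ edgeVector c (Sum.inr v) = ∑ p ∈ c.support with p.2 = v, c p := by
  simp [Finsupp.linearCombination_apply, Finsupp.sum, edgeVector_inr, Finset.sum_filter]

variable {G : SimpleGraph (E ⊕ V)}

/-- The vertices of the root polytope of `G`, indexed by the edges of `G`. -/
def graphEdgeVector (G : SimpleGraph (E ⊕ V)) :
    {p : E × V // G.Adj (Sum.inl p.1) (Sum.inr p.2)} → E ⊕ V → ℝ :=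
  edgeVector ∘ Subtype.val

theorem rootPolytope_eq (G : SimpleGraph (E ⊕ V)) :
    rootPolytope G = convexHull ℝ (Set.range (graphEdgeVector G)) := by
  rw [rootPolytope]
  congr 1
  ext x
  simp [graphEdgeVector, edgeVector, eq_comm]

theorem ehrhart_eq (G : SimpleGraph (E ⊕ V)) (s : ℕ) :
    ehrhart G s = latticePointCount (convexHull ℝ (Set.range (graphEdgeVector G)))
      (integerLattice (E ⊕ V)) s := by
  simp only [ehrhart, latticePointCount, rootPolytope_eq, mem_integerLattice,
    AddMonoidHom.mem_range, Int.coe_castAddHom, eq_comm]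

theorem single_add_single_mem_range_graphEdgeVector (hbip : G ≤ completeBipartiteGraph E V)
    {x y : E ⊕ V} (h : G.Adj x y) :
    (Pi.single x 1 + Pi.single y 1 : E ⊕ V → ℝ) ∈ Set.range (graphEdgeVector G) := by
  rcases x with e | v <;> rcases y with e' | v'
  · simpa using hbip h
  · exact ⟨⟨(e, v'), h⟩, rfl⟩
  · exact ⟨⟨(e', v), h.symm⟩, add_comm _ _⟩
  · simpa using hbip h

theorem single_mem_span_graphEdgeVector_sup (hbip : G ≤ completeBipartiteGraph E V)
    {x y : E ⊕ V} (h : G.Reachable x y) :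
    (Pi.single y 1 : E ⊕ V → ℝ) ∈ Submodule.span ℝ (Set.range (graphEdgeVector G)) ⊔
      Submodule.span ℝ {Pi.single x 1} := by
  induction (SimpleGraph.reachable_iff_reflTransGen x y).1 h with
  | refl => exact Submodule.mem_sup_right (Submodule.mem_span_singleton_self _)
  | tail hreach hadj ih =>
    rw [← SimpleGraph.reachable_iff_reflTransGen] at hreach
    refine ((Submodule.add_mem_iff_right _ (ih hreach)).1 ?_)
    exact Submodule.mem_sup_left
      (Submodule.subset_span (single_add_single_mem_range_graphEdgeVector hbip hadj))

/-- The sum of the coordinates indexed by `E`. -/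
def sumLeft (E V : Type*) [Fintype E] : (E ⊕ V → ℝ) →ₗ[ℝ] ℝ :=
  ∑ e : E, LinearMap.proj (Sum.inl e)

/-- The sum of the coordinates indexed by `V`. -/
def sumRight (E V : Type*) [Fintype V] : (E ⊕ V → ℝ) →ₗ[ℝ] ℝ :=
  ∑ v : V, LinearMap.proj (Sum.inr v)

theorem sumLeft_edgeVector [Fintype E] (p : E × V) : sumLeft E V (edgeVector p) = 1 := by
  simp [sumLeft, edgeVector_inl]

theorem sumRight_edgeVector [Fintype V] (p : E × V) : sumRight E V (edgeVector p) = 1 := by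
  simp [sumRight, edgeVector_inr]

variable [Finite E] [Finite V]

theorem single_notMem_span_edgeVector (x : E ⊕ V) :
    (Pi.single x 1 : E ⊕ V → ℝ) ∉ Submodule.span ℝ (Set.range edgeVector) := by
  have := Fintype.ofFinite E
  have := Fintype.ofFinite V
  intro hx
  have span_le : Submodule.span ℝ (Set.range edgeVector) ≤ (sumLeft E V - sumRight E V).ker := by
    rw [Submodule.span_le]
    rintro _ ⟨p, rfl⟩
    simp [sumLeft_edgeVector, sumRight_edgeVector]
  have := LinearMap.mem_ker.1 (span_le hx)
  cases x <;> simp [sumLeft, sumRight, Pi.single_apply] at this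

theorem card_lt_of_linearIndepOn_edgeVector {F : Finset (E × V)} (hne : F.Nonempty)
    (hF : LinearIndepOn ℝ edgeVector (F : Set (E × V))) :
    F.card < (F.image Prod.fst).card + (F.image Prod.snd).card := by
  let S : Finset (E ⊕ V) := (F.image Prod.fst).disjSum (F.image Prod.snd)
  let b : E ⊕ V → E ⊕ V → ℝ := fun x ↦ Pi.single x 1
  have finrank_S : Module.finrank ℝ (Submodule.span ℝ (b '' S)) = S.card :=
    finrank_span_image_of_linearIndepOn
      ((Pi.linearIndependent_single_one (E ⊕ V) ℝ).linearIndepOn _)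
  rw [← Finset.card_disjSum, ← finrank_S, ← finrank_span_image_of_linearIndepOn hF]
  refine Submodule.finrank_lt_finrank_of_lt (SetLike.lt_iff_le_and_exists.2 ⟨?_, ?_⟩)
  · rw [Submodule.span_le]
    rintro _ ⟨p, hp, rfl⟩
    exact add_mem
      (Submodule.subset_span ⟨_, Finset.inl_mem_disjSum.2 (Finset.mem_image_of_mem _ hp), rfl⟩)
      (Submodule.subset_span ⟨_, Finset.inr_mem_disjSum.2 (Finset.mem_image_of_mem _ hp), rfl⟩)
  · obtain ⟨p, hp⟩ := hne
    refine ⟨b (Sum.inl p.1), Submodule.subset_span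
      ⟨_, Finset.inl_mem_disjSum.2 (Finset.mem_image_of_mem _ hp), rfl⟩, fun h ↦ ?_⟩
    exact single_notMem_span_edgeVector _ (Submodule.span_mono (Set.image_subset_range _ _) h)

theorem isUnimodular_edgeVector : IsUnimodular edgeVector (integerLattice (E ⊕ V)) where
  mem p := by
    rw [mem_integerLattice]
    rintro (e | v)
    · rw [edgeVector_inl]; split_ifs; exacts [⟨1, by simp⟩, ⟨0, by simp⟩]
    · rw [edgeVector_inr]; split_ifs; exacts [⟨1, by simp⟩, ⟨0, by simp⟩]
  integral {c} hc hcL := by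
    classical
    let H : AddSubgroup ℝ := (Int.castAddHom ℝ).range
    suffices integral : ∀ p, c p ∈ H from fun p ↦ let ⟨k, hk⟩ := integral p; ⟨k, hk.symm⟩
    by_contra! h
    obtain ⟨p, hp⟩ := h
    let F : Finset (E × V) := {p ∈ c.support | c p ∉ H}
    have p_mem : p ∈ F := Finset.mem_filter.2
      ⟨Finsupp.mem_support_iff.2 fun h0 ↦ hp (h0 ▸ zero_mem H), hp⟩
    have card_lt := card_lt_of_linearIndepOn_edgeVector ⟨p, p_mem⟩
      (hc.mono (Finset.coe_subset.2 (Finset.filter_subset _ _)))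
    have two_mul_left : 2 * (F.image Prod.fst).card ≤ F.card :=
      two_mul_card_image_filter_notMem_le fun e ↦
        linearCombination_edgeVector_inl c e ▸ mem_integerLattice.1 hcL (Sum.inl e)
    have two_mul_right : 2 * (F.image Prod.snd).card ≤ F.card :=
      two_mul_card_image_filter_notMem_le fun v ↦
        linearCombination_edgeVector_inr c v ▸ mem_integerLattice.1 hcL (Sum.inr v)
    omega

theorem finrank_span_graphEdgeVector_add_one {E V : Type*} [Fintype E] [Fintype V] [DecidableEq E]
    [DecidableEq V] {G : SimpleGraph (E ⊕ V)} (hbip : G ≤ completeBipartiteGraph E V)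
    (hconn : G.Connected) :
    Module.finrank ℝ (Submodule.span ℝ (Set.range (graphEdgeVector G))) + 1 =
      Fintype.card E + Fintype.card V := by
  obtain ⟨x⟩ := hconn.nonempty
  have x_notMem : (Pi.single x 1 : E ⊕ V → ℝ) ∉
      Submodule.span ℝ (Set.range (graphEdgeVector G)) := fun h ↦
    single_notMem_span_edgeVector x (Submodule.span_mono (Set.range_comp_subset_range _ _) h)
  have isCompl : IsCompl (Submodule.span ℝ (Set.range (graphEdgeVector G)))
      (Submodule.span ℝ {Pi.single x 1}) := by
    refine ⟨Submodule.disjoint_span_singleton_of_notMem x_notMem, codisjoint_iff_le_sup.2 ?_⟩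
    rw [← (Pi.basisFun ℝ (E ⊕ V)).span_eq, Submodule.span_le]
    rintro _ ⟨y, rfl⟩
    rw [Pi.basisFun_apply]
    exact single_mem_span_graphEdgeVector_sup hbip (hconn.preconnected x y)
  have single_ne_zero : (Pi.single x 1 : E ⊕ V → ℝ) ≠ 0 := by simp
  rw [← finrank_span_singleton (K := ℝ) single_ne_zero,
    Submodule.finrank_add_eq_of_isCompl isCompl, Module.finrank_fintype_fun_eq_card,
    Fintype.card_sum]

end RootPolytopes

end RootPolytope

end

theorem theorem3p6_general {ι W : Type*} [Finite ι] [AddCommGroup W] [Module ℝ W] {v : ι → W}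
    (hv : Function.Injective v) {L : AddSubgroup W} (hL : RootPolytope.IsUnimodular v L)
    {φ : W →ₗ[ℝ] ℝ} (hφ : ∀ i, φ (v i) = 1) {d : ℕ}
    (hd : Module.finrank ℝ (Submodule.span ℝ (Set.range v)) = d + 1) :
    (∃! a : Fin (d + 1) → ℚ, RootPolytope.IsBinomialExpansion
      (fun s ↦ (RootPolytope.latticePointCount (convexHull ℝ (Set.range v)) L s : ℚ)) d a) ∧
    (∀ a : Fin (d + 1) → ℚ, RootPolytope.IsBinomialExpansion
        (fun s ↦ (RootPolytope.latticePointCount (convexHull ℝ (Set.range v)) L s : ℚ)) d a →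
      ∀ T : Finset (Finset W), RootPolytope.IsTriangulation (convexHull ℝ (Set.range v)) T →
        ∀ x : ℚ, x ≠ 0 → x ^ (d + 1) * (RootPolytope.hVector T).eval x⁻¹ =
          ∑ k : Fin (d + 1), a k * x ^ (k : ℕ)) ∧
    (∀ T₁ T₂ : Finset (Finset W),
      RootPolytope.IsTriangulation (convexHull ℝ (Set.range v)) T₁ →
      RootPolytope.IsTriangulation (convexHull ℝ (Set.range v)) T₂ →
      RootPolytope.hVector T₁ = RootPolytope.hVector T₂) := by
  have : Nonempty ι := by
    by_contra! h
    rw [Set.range_eq_empty, Submodule.span_empty, finrank_bot] at hd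
    exact (Nat.succ_ne_zero d).symm hd
  have expansion := RootPolytope.existsUnique_isBinomialExpansion_latticePointCount hL hφ hd
  refine ⟨expansion, fun a ha T hT x hx ↦ hT.pow_mul_eval_hVector_eq_sum hv hφ hL hd ha hx,
    fun T₁ T₂ hT₁ hT₂ ↦ ?_⟩
  obtain ⟨a, ha, -⟩ := expansion
  refine RootPolytope.eq_of_forall_eval_inv_eq fun x hx ↦
    mul_left_cancel₀ (pow_ne_zero (d + 1) hx) ?_
  rw [hT₁.pow_mul_eval_hVector_eq_sum hv hφ hL hd ha hx,
    hT₂.pow_mul_eval_hVector_eq_sum hv hφ hL hd ha hx]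

theorem theorem3p6 {E V : Type*} [Fintype E] [Fintype V] [DecidableEq E] [DecidableEq V]
    (G : SimpleGraph (E ⊕ V)) (hbip : G ≤ completeBipartiteGraph E V) (hconn : G.Connected)
    (d : ℕ) (hd : Fintype.card E + Fintype.card V = d + 2) :
    (∃! a : Fin (d + 1) → ℚ, RootPolytope.IsEhrhartExpansion G d a) ∧
    (∀ a : Fin (d + 1) → ℚ, RootPolytope.IsEhrhartExpansion G d a →
      ∀ T : Finset (Finset (E ⊕ V → ℝ)),
        RootPolytope.IsTriangulation (RootPolytope.rootPolytope G) T →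
        ∀ x : ℚ, x ≠ 0 →
          x ^ (d + 1) * (RootPolytope.hVector T).eval x⁻¹ =
            ∑ k : Fin (d + 1), a k * x ^ (k : ℕ)) ∧
    (∀ T₁ T₂ : Finset (Finset (E ⊕ V → ℝ)),
      RootPolytope.IsTriangulation (RootPolytope.rootPolytope G) T₁ →
      RootPolytope.IsTriangulation (RootPolytope.rootPolytope G) T₂ →
      RootPolytope.hVector T₁ = RootPolytope.hVector T₂) := by
  have finrank_eq := RootPolytope.finrank_span_graphEdgeVector_add_one hbip hconn
  simp only [RootPolytope.IsEhrhartExpansion, RootPolytope.ehrhart_eq, RootPolytope.rootPolytope_eq]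
  exact theorem3p6_general (v := RootPolytope.graphEdgeVector G)
    (RootPolytope.edgeVector_injective.comp Subtype.val_injective)
    (RootPolytope.isUnimodular_edgeVector.comp Subtype.val_injective)
    (fun p ↦ RootPolytope.sumLeft_edgeVector p.1) (by omega)
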